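/- Let $n$ be a positive integer and write $[n]=\{1,\dots,n\}$. A flag of $[n]$ is a set $f$ of non-empty proper subsets of $[n]$ such that $X\subseteq Y$ or $Y\subseteq X$ for all $X,Y\in f$; its type is the set $\{|X| : X\in f\}$. For $T\subseteq[n-1]$, the general position graph $\Gamma(n,T)$ is the simple graph whose vertices are the flags of $[n]$ of type $T$, two distinct vertices $f,g$ being adjacent if and only if $X\cap Y=\emptyset$ or $X\cup Y=[n]$ for all $X\in f$ and $Y\in g$. Theorem. Let $T=\{a,b\}\subseteq[n-1]$ with $a<\frac n2<b$ and $a+b\neq n$. Then the full automorphism group $\mathrm{Aut}(\Gamma(n,T))$ is isomorphic, as a group, to the symmetric group $S_n$. -/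

import Mathlib

/-- A flag of `[n]` (modelled by `Fin n`): a set of non-empty proper subsets of `[n]`, any two of
which are comparable under inclusion. -/
def IsFlag {n : ℕ} (f : Finset (Finset (Fin n))) : Prop :=
  (∀ X ∈ f, X.Nonempty ∧ X ≠ Finset.univ) ∧ ∀ X ∈ f, ∀ Y ∈ f, X ⊆ Y ∨ Y ⊆ X

/-- The type of a flag: the set of cardinalities of its members. -/
def flagType {n : ℕ} (f : Finset (Finset (Fin n))) : Finset ℕ :=
  f.image Finset.card

/-- The flags of `[n]` of type `T`. -/
def FlagOfType (n : ℕ) (T : Finset ℕ) : Type :=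
  {f : Finset (Finset (Fin n)) // IsFlag f ∧ flagType f = T}

/-- Two flags are in general position if `X ∩ Y = ∅` or `X ∪ Y = [n]` for all members `X` of the
first and `Y` of the second. -/
def InGeneralPosition {n : ℕ} (f g : Finset (Finset (Fin n))) : Prop :=
  ∀ X ∈ f, ∀ Y ∈ g, X ∩ Y = ∅ ∨ X ∪ Y = Finset.univ

/-- The general position graph `Γ(n, T)`. The condition `f ≠ g` only matters for `T = ∅`:
see `generalPositionGraph_adj`. -/
def generalPositionGraph (n : ℕ) (T : Finset ℕ) : SimpleGraph (FlagOfType n T) where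
  Adj f g := f ≠ g ∧ InGeneralPosition f.1 g.1
  symm := ⟨fun f g h => ⟨h.1.symm, fun X hX Y hY => by
    rw [Finset.inter_comm, Finset.union_comm]
    exact h.2 Y hY X hX⟩⟩
  loopless := ⟨fun _ h => h.1 rfl⟩

/-- For non-empty `T`, adjacency in `Γ(n, T)` is exactly being in general position. -/
theorem generalPositionGraph_adj {n : ℕ} {T : Finset ℕ} (hT : T.Nonempty)
    (f g : FlagOfType n T) :
    (generalPositionGraph n T).Adj f g ↔ InGeneralPosition f.1 g.1 := by
  refine ⟨fun h => h.2, fun h => ⟨?_, h⟩⟩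
  rintro rfl
  have hne : f.1.Nonempty := by
    rw [← Finset.image_nonempty (f := Finset.card)]
    have h2 := f.2.2
    unfold flagType at h2
    rw [h2]
    exact hT
  obtain ⟨X, hX⟩ := hne
  have hp := f.2.1.1 X hX
  rcases h X hX X hX with h1 | h1
  · rw [Finset.inter_self] at h1
    exact hp.1.ne_empty h1
  · rw [Finset.union_self] at h1
    exact hp.2 h1

/-! A flag `A ⊆ B` is encoded by the disjoint pair `A`, `Bᶜ`, whose sizes `a` and `n - b` are both
below `n / 2` and differ because `a + b ≠ n`. With the smaller set listed first, of sizes `a < c`,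
size constraints discard most alternatives of general position and leave `pairRel`.

The work is to recover the sets from the graph. Two vertices whose common neighbourhood is as large
as possible (`IsMaxPair`) differ by exchanging one element in exactly one member. If `2 * c + 1 =
n`, only exchanges in the first member are maximal; otherwise both kinds occur, and the number of
triangles on such a pair tells them apart because `a ≠ c` (`fstAdj_iff`). So automorphisms preserve
exchanges in the first member and hence, by connectedness of Johnson graphs, equality of second
members (`snd_eq_of_snd_eq`).

An automorphism therefore acts on the `c`-sets, and does so as an automorphism of the Kneser graph,
which comes from a permutation (`exists_perm_of_kneserRel_iso`). After dividing by that permutation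
all second members are fixed, and the first member of a vertex is the intersection of the second
members of its neighbours, so nothing moves (`eq_self_of_snd_eq`). -/

theorem subset_of_forall_subset {α : Type*} {X Y : Finset α} {k : ℕ} (hk : 1 ≤ k) (hX : k ≤ X.card)
    (h : ∀ C, C ⊆ X → C.card = k → C ⊆ Y) : X ⊆ Y := by
  intro x hx
  obtain ⟨C, h1, h2, h3⟩ := Finset.exists_subsuperset_card_eq
    (Finset.singleton_subset_iff.2 hx) (by simpa using hk) hX
  exact h C h2 h3 (h1 (Finset.mem_singleton_self x))

/-! ### Johnson adjacency and recovering sets from their supersets -/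

section FinsetLemmas

variable {α : Type*} [DecidableEq α]

/-- Two finite sets of the same size that differ by the exchange of one element. -/
def JohnsonAdj (K L : Finset α) : Prop :=
  K.card = L.card ∧ (K \ L).card = 1

instance (K L : Finset α) : Decidable (JohnsonAdj K L) :=
  inferInstanceAs (Decidable (_ ∧ _))

theorem JohnsonAdj.symm {K L : Finset α} (h : JohnsonAdj K L) : JohnsonAdj L K :=
  ⟨h.1.symm, by rw [Finset.card_sdiff_comm h.1.symm]; exact h.2⟩

theorem JohnsonAdj.ne {K L : Finset α} (h : JohnsonAdj K L) : K ≠ L := by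
  rintro rfl
  have := h.2
  simp at this

theorem JohnsonAdj.exists_eq {K L : Finset α} (h : JohnsonAdj K L) :
    ∃ x ∈ K, ∃ y ∉ K, L = insert y (K.erase x) := by
  obtain ⟨x, hx⟩ := Finset.card_eq_one.1 h.2
  obtain ⟨y, hy⟩ := Finset.card_eq_one.1 h.symm.2
  have h1 : ∀ z, (z ∈ K ∧ z ∉ L) ↔ z = x := fun z => by
    rw [← Finset.mem_sdiff, hx, Finset.mem_singleton]
  have h2 : ∀ z, (z ∈ L ∧ z ∉ K) ↔ z = y := fun z => by
    rw [← Finset.mem_sdiff, hy, Finset.mem_singleton]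
  refine ⟨x, ((h1 x).2 rfl).1, y, ((h2 y).2 rfl).2, ?_⟩
  ext z
  simp only [Finset.mem_insert, Finset.mem_erase]
  have := h1 z
  have := h2 z
  tauto

theorem card_insert_erase {K : Finset α} {x y : α} (hx : x ∈ K) (hy : y ∉ K) :
    (insert y (K.erase x)).card = K.card := by
  rw [Finset.card_insert_of_notMem (fun h => hy (Finset.mem_of_mem_erase h)),
    Finset.card_erase_add_one hx]

theorem johnsonAdj_insert_erase {K : Finset α} {x y : α} (hx : x ∈ K) (hy : y ∉ K) :
    JohnsonAdj K (insert y (K.erase x)) := by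
  refine ⟨(card_insert_erase hx hy).symm, Finset.card_eq_one.2 ⟨x, ?_⟩⟩
  ext z
  simp only [Finset.mem_sdiff, Finset.mem_insert, Finset.mem_erase, Finset.mem_singleton]
  constructor
  · tauto
  · rintro rfl
    refine ⟨hx, ?_⟩
    rintro (rfl | h)
    · exact hy hx
    · exact h.1 rfl

theorem exists_mem_notMem_of_card_eq {K L : Finset α} (hc : K.card = L.card) (hne : K ≠ L) :
    ∃ x ∈ K, x ∉ L := by
  by_contra! h
  exact hne (Finset.eq_of_subset_of_card_le h hc.ge)

theorem johnsonAdj_of_subset_insert {K L : Finset α} {y : α} (hc : K.card = L.card)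
    (hne : K ≠ L) (h : L ⊆ insert y K) : JohnsonAdj K L := by
  refine JohnsonAdj.symm ⟨hc.symm, Finset.card_eq_one.2 ⟨y, ?_⟩⟩
  obtain ⟨z, hz, hz'⟩ := exists_mem_notMem_of_card_eq hc.symm hne.symm
  ext u
  simp only [Finset.mem_sdiff, Finset.mem_singleton]
  constructor
  · rintro ⟨h1, h2⟩
    exact (Finset.mem_insert.1 (h h1)).resolve_right h2
  · rintro rfl
    have := (Finset.mem_insert.1 (h hz)).resolve_right hz'
    exact this ▸ ⟨hz, hz'⟩

theorem johnsonAdj_of_erase_subset {K L : Finset α} {x : α} (hx : x ∈ K) (hc : K.card = L.card)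
    (hne : K ≠ L) (h : K.erase x ⊆ L) : JohnsonAdj K L := by
  refine ⟨hc, Finset.card_eq_one.2 ⟨x, ?_⟩⟩
  obtain ⟨z, hz, hz'⟩ := exists_mem_notMem_of_card_eq hc hne
  have key : ∀ u ∈ K, u ∉ L → u = x := fun u hu hu' => by
    by_contra hux
    exact hu' (h (Finset.mem_erase.2 ⟨hux, hu⟩))
  ext u
  simp only [Finset.mem_sdiff, Finset.mem_singleton]
  constructor
  · rintro ⟨h1, h2⟩
    exact key u h1 h2
  · rintro rfl
    exact key z hz hz' ▸ ⟨hz, hz'⟩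

/-- Every edge of the Johnson graph on the subsets of `S` lies in `#S - 2` triangles. -/
theorem card_johnsonAdj_common {S K L : Finset α} (hK : K ⊆ S) (hL : L ⊆ S)
    (h : JohnsonAdj K L) :
    (S.powerset.filter fun M => JohnsonAdj K M ∧ JohnsonAdj L M).card = S.card - 2 := by
  obtain ⟨x, hx, y, hy, rfl⟩ := h.exists_eq
  have hxy : x ≠ y := fun e => hy (e ▸ hx)
  have hyS : y ∈ S := hL (Finset.mem_insert_self _ _)
  have hxS : x ∈ S := hK hx
  have hcard : ((S.erase x).erase y).card = S.card - 2 := by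
    rw [Finset.card_erase_of_mem (Finset.mem_erase.2 ⟨hxy.symm, hyS⟩),
      Finset.card_erase_of_mem hxS]
    omega
  rw [← hcard]
  symm
  -- With `L = K - x + y`, the third vertex of a triangle is `K - s + y` for `s ∈ K`, or `K - x + s`
  -- for `s ∉ K`; the parameter `s` runs over `S` without `x` and `y`.
  refine Finset.card_bij
    (fun s _ => if s ∈ K then insert y (K.erase s) else insert s (K.erase x)) ?_ ?_ ?_
  · intro s hs
    obtain ⟨hsy, hsx, hsS⟩ : s ≠ y ∧ s ≠ x ∧ s ∈ S := by
      simpa only [Finset.mem_erase] using hs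
    rw [Finset.mem_filter, Finset.mem_powerset]
    split_ifs with hsK
    · refine ⟨Finset.insert_subset hyS ((Finset.erase_subset _ _).trans hK),
        johnsonAdj_insert_erase hsK hy, ?_⟩
      refine johnsonAdj_of_subset_insert (y := x) ?_ ?_ ?_
      · rw [card_insert_erase hsK hy, card_insert_erase hx hy]
      · intro e
        have : s ∈ insert y (K.erase s) := e ▸ by simp [hsK, hsx]
        simp [hsy] at this
      · intro u
        simp only [Finset.mem_insert, Finset.mem_erase]
        tauto
    · refine ⟨Finset.insert_subset hsS ((Finset.erase_subset _ _).trans hK),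
        johnsonAdj_insert_erase hx hsK, ?_⟩
      refine johnsonAdj_of_subset_insert (y := s) ?_ ?_ ?_
      · rw [card_insert_erase hx hsK, card_insert_erase hx hy]
      · intro e
        have : s ∈ insert y (K.erase x) := e ▸ by simp
        simp [hsy, hsK] at this
      · intro u
        simp only [Finset.mem_insert, Finset.mem_erase]
        tauto
  · intro s hs t ht hst
    obtain ⟨hsy, hsx, hsS⟩ : s ≠ y ∧ s ≠ x ∧ s ∈ S := by
      simpa only [Finset.mem_erase] using hs
    obtain ⟨hty, htx, htS⟩ : t ≠ y ∧ t ≠ x ∧ t ∈ S := by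
      simpa only [Finset.mem_erase] using ht
    have h1 := Finset.ext_iff.1 hst s
    have h2 := Finset.ext_iff.1 hst t
    have h3 := Finset.ext_iff.1 hst y
    by_cases hsK : s ∈ K <;> by_cases htK : t ∈ K <;>
      simp only [hsK, htK, if_true, if_false, Finset.mem_insert, Finset.mem_erase] at h1 h2 h3 <;>
      grind
  · intro M hM
    rw [Finset.mem_filter, Finset.mem_powerset] at hM
    obtain ⟨hMS, hKM, hLM⟩ := hM
    obtain ⟨p, hp, z, hz, rfl⟩ := hKM.exists_eq
    have hne := hLM.ne
    obtain ⟨w, hw⟩ := Finset.card_eq_one.1 hLM.2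
    have hw' : ∀ u, u ∈ insert y (K.erase x) → u ∉ insert z (K.erase p) → u = w := fun u h1 h2 => by
      rw [← Finset.mem_singleton, ← hw]
      exact Finset.mem_sdiff.2 ⟨h1, h2⟩
    have hzS : z ∈ S := hMS (Finset.mem_insert_self _ _)
    by_cases hzy : z = y
    · subst hzy
      have hpx : p ≠ x := fun e => hne (by rw [e])
      have hpz : p ≠ z := fun e => hz (e ▸ hp)
      exact ⟨p, by simp [hpx, hpz, hK hp], by simp [hp]⟩
    · have hpx : p = x := by
        by_contra hpx
        have hpz : p ≠ z := fun e => hz (e ▸ hp)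
        -- If neither `z = y` nor `p = x`, both `y` and `p` lie in the one-element difference of `L`
        -- and `M`.
        have e1 := hw' y (by simp) (by simp [Ne.symm hzy, hy])
        have e2 := hw' p (by simp [hp, hpx]) (by simp [hpz])
        exact hy (e1.trans e2.symm ▸ hp)
      subst hpx
      have hzp : z ≠ p := fun e => hz (e ▸ hp)
      exact ⟨z, by simp [hzy, hzp, hzS], by simp [hz]⟩

/-- `Y` is the intersection of the `k`-sets between `Y` and `W`: since `k < W.card`, any single
point outside `Y` can be avoided. -/
theorem subset_of_forall_superset {X Y W : Finset α} {k : ℕ} (hYW : Y ⊆ W) (hY : Y.card ≤ k)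
    (hW : k < W.card) (h : ∀ Q, Y ⊆ Q → Q ⊆ W → Q.card = k → X ⊆ Q) : X ⊆ Y := by
  intro x hx
  by_contra hxY
  have hle : k ≤ (W.erase x).card := by
    have := Finset.pred_card_le_card_erase (s := W) (a := x)
    omega
  obtain ⟨Q, h1, h2, h3⟩ := Finset.exists_subsuperset_card_eq
    (s := Y) (t := W.erase x) (fun y hy => Finset.mem_erase.2 ⟨fun e => hxY (e ▸ hy), hYW hy⟩)
    hY hle
  have := h2 (h Q h1 (h2.trans (Finset.erase_subset _ _)) h3 hx)
  simp at this

/-- `W` is the union of the `k`-sets between `Y` and `W`: since `Y.card < k`, there is room to add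
any prescribed point of `W`. -/
theorem disjoint_of_forall_superset {X Y W : Finset α} {k : ℕ} (hYW : Y ⊆ W) (hY : Y.card < k)
    (hW : k ≤ W.card) (h : ∀ Q, Y ⊆ Q → Q ⊆ W → Q.card = k → Disjoint X Q) : Disjoint X W := by
  rw [Finset.disjoint_right]
  intro w hw
  obtain ⟨Q, h1, h2, h3⟩ := Finset.exists_subsuperset_card_eq
    (s := insert w Y) (Finset.insert_subset hw hYW)
    ((Finset.card_insert_le _ _).trans hY) hW
  exact Finset.disjoint_right.1 (h Q ((Finset.subset_insert _ _).trans h1) h2 h3)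
    (h1 (Finset.mem_insert_self _ _))

end FinsetLemmas

/-! ### Maximal pairs, an isomorphism invariant of a relation -/

section MaxPair

variable {V W : Type*} {r : V → V → Prop} {s : W → W → Prop}

/-- Distinct `v`, `w` that have a common neighbour, and whose set of common neighbours is
inclusion-maximal among those of the pairs `v`, `w'` with `w' ≠ v`. -/
def IsMaxPair (r : V → V → Prop) (v w : V) : Prop :=
  v ≠ w ∧ (∃ u, r v u ∧ r w u) ∧
    ∀ w', w' ≠ v → (∀ u, r v u → r w u → r w' u) → ∀ u, r v u → r w' u → r w u

theorem IsMaxPair.map (e : r ≃r s) {v w : V} (h : IsMaxPair r v w) :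
    IsMaxPair s (e v) (e w) := by
  obtain ⟨h1, ⟨u, hu⟩, h2⟩ := h
  refine ⟨fun h => h1 (e.injective h), ⟨e u, e.map_rel_iff.2 hu.1, e.map_rel_iff.2 hu.2⟩, ?_⟩
  intro w' hw' hs u h3 h4
  obtain ⟨w', rfl⟩ := e.surjective w'
  obtain ⟨u, rfl⟩ := e.surjective u
  rw [e.map_rel_iff] at *
  refine h2 w' (fun h => hw' (by rw [h])) (fun u h5 h6 => ?_) u h3 h4
  have := hs (e u)
  simp only [e.map_rel_iff] at this
  exact this h5 h6

theorem isMaxPair_map_iff (e : r ≃r s) {v w : V} :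
    IsMaxPair s (e v) (e w) ↔ IsMaxPair r v w :=
  ⟨fun h => by simpa using h.map e.symm, fun h => h.map e⟩

/-- The number of vertices that form a maximal pair with both `v` and `w`. -/
noncomputable def maxPairCodegree (r : V → V → Prop) (v w : V) : ℕ :=
  {u | IsMaxPair r v u ∧ IsMaxPair r w u}.ncard

theorem maxPairCodegree_map (e : r ≃r s) (v w : V) :
    maxPairCodegree s (e v) (e w) = maxPairCodegree r v w := by
  unfold maxPairCodegree
  rw [← Set.ncard_image_of_injective _ e.injective]
  congr 1
  ext u
  obtain ⟨u, rfl⟩ := e.surjective u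
  simp only [Set.mem_ofPred_eq, isMaxPair_map_iff, Set.mem_image, e.injective.eq_iff,
    exists_eq_right]

end MaxPair

/-! ### Automorphisms of Kneser graphs -/

section Kneser

variable {α : Type*} [DecidableEq α]

/-- A common Johnson neighbour of `K` and `L` either contains `K ∩ L` or lies in `K ∪ L`, never
both. Excluding the second kind describes the star over `K ∩ L` by conditions that can be read off
the Kneser graph. -/
theorem inter_subset_iff_of_johnsonAdj {K L M : Finset α} (h : JohnsonAdj K L)
    (hM : K.card = M.card) :
    K ∩ L ⊆ M ↔ M = K ∨ M = L ∨ JohnsonAdj K M ∧ JohnsonAdj L M ∧ ¬ M ⊆ K ∪ L := by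
  constructor
  · intro hI
    by_cases hMK : M = K
    · exact Or.inl hMK
    by_cases hML : M = L
    · exact Or.inr (Or.inl hML)
    refine Or.inr (Or.inr ⟨?_, ?_, ?_⟩)
    · obtain ⟨x, hx, y, hy, rfl⟩ := h.exists_eq
      refine johnsonAdj_of_erase_subset hx hM (Ne.symm hMK) (Finset.Subset.trans ?_ hI)
      intro u
      simp only [Finset.mem_inter, Finset.mem_insert, Finset.mem_erase]
      tauto
    · obtain ⟨x, hx, y, hy, rfl⟩ := h.symm.exists_eq
      refine johnsonAdj_of_erase_subset hx (h.1.symm.trans hM) (Ne.symm hML)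
        (Finset.Subset.trans ?_ hI)
      intro u
      simp only [Finset.mem_inter, Finset.mem_insert, Finset.mem_erase]
      tauto
    · intro hU
      obtain ⟨x, hx, y, hy, rfl⟩ := h.exists_eq
      obtain ⟨u, hu, huK⟩ := exists_mem_notMem_of_card_eq hM.symm hMK
      obtain ⟨v, hv, hvL⟩ := exists_mem_notMem_of_card_eq (hM.symm.trans h.1) hML
      have huy : u = y := by
        have := hU hu
        simp only [Finset.mem_union, Finset.mem_insert, Finset.mem_erase] at this
        tauto
      have hvx : v = x := by
        have := hU hv
        simp only [Finset.mem_union, Finset.mem_insert, Finset.mem_erase] at this hvL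
        tauto
      subst huy hvx
      have hKM : K ⊆ M := fun w hw => by
        by_cases hwv : w = v
        · exact hwv ▸ hv
        · exact hI (by simp [hw, hwv])
      exact hMK (Finset.eq_of_subset_of_card_le hKM hM.ge).symm
  · rintro (rfl | rfl | ⟨h1, h2, h3⟩)
    · exact Finset.inter_subset_left
    · exact Finset.inter_subset_right
    · obtain ⟨x, hx, y, hy, rfl⟩ := h.exists_eq
      obtain ⟨p, hp, z, hz, rfl⟩ := h1.exists_eq
      have hzy : z ≠ y := by
        rintro rfl
        apply h3
        intro u
        simp only [Finset.mem_union, Finset.mem_insert, Finset.mem_erase]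
        tauto
      obtain ⟨w, hw⟩ := Finset.card_eq_one.1 h2.2
      have hw' : ∀ u, u ∈ insert y (K.erase x) → u ∉ insert z (K.erase p) → u = w :=
        fun u h1 h2 => by
          rw [← Finset.mem_singleton, ← hw]
          exact Finset.mem_sdiff.2 ⟨h1, h2⟩
      have hpx : p = x := by
        by_contra hpx
        have hpz : p ≠ z := fun e => hz (e ▸ hp)
        have e1 := hw' y (by simp) (by simp [Ne.symm hzy, hy])
        have e2 := hw' p (by simp [hp, hpx]) (by simp [hpz])
        exact hy (e1.trans e2.symm ▸ hp)
      subst hpx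
      intro u
      simp only [Finset.mem_inter, Finset.mem_insert, Finset.mem_erase]
      rintro ⟨h4, rfl | h5⟩
      · exact absurd h4 hy
      · exact Or.inr h5

/-- The adjacency relation of the Kneser graph on the `c`-element sets. -/
def kneserRel (α : Type*) (c : ℕ) (P Q : {P : Finset α // P.card = c}) : Prop :=
  Disjoint P.1 Q.1

variable [Fintype α] {c : ℕ}

/-- The sets `Q` in question are the `c`-subsets of the complement of `insert z P`. That complement
has at least `c` elements, so for `c > 0` these subsets cover it. -/
theorem subset_insert_iff_kneserRel (hc : 2 * c < Fintype.card α) (P R : {P : Finset α // P.card = c})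
    {z : α} : R.1 ⊆ insert z P.1 ↔
      ∀ Q : {P : Finset α // P.card = c}, kneserRel α c P Q → z ∉ Q.1 → kneserRel α c R Q := by
  constructor
  · intro h Q hPQ hz
    refine Finset.disjoint_of_subset_left h ?_
    rw [Finset.disjoint_insert_left]
    exact ⟨hz, hPQ⟩
  · intro h
    by_cases hc0 : c = 0
    · rw [Finset.card_eq_zero.1 (R.2.trans hc0)]
      exact Finset.empty_subset _
    have hcard : c ≤ ((insert z P.1)ᶜ : Finset α).card := by
      rw [Finset.card_compl]
      have := Finset.card_insert_le z P.1
      have := P.2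
      omega
    have := disjoint_of_forall_superset (X := R.1) (Y := ∅) (W := (insert z P.1)ᶜ) (k := c)
      (Finset.empty_subset _) (by simp; omega) hcard (fun Q _ hQ hQc => by
        refine h ⟨Q, hQc⟩ ?_ ?_
        · refine Finset.disjoint_right.2 fun u hu hu' => ?_
          have := hQ hu
          simp [hu'] at this
        · intro hz
          have := hQ hz
          simp at this)
    exact disjoint_compl_right_iff.1 this

/-- Common neighbours of `P` and `R` are the `c`-sets avoiding `P ∪ R`, so a maximal pair is one
whose union is minimal, that is, one element larger than `P`. -/
theorem isMaxPair_kneserRel_iff (hc : 2 * c < Fintype.card α)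
    (P R : {P : Finset α // P.card = c}) :
    IsMaxPair (kneserRel α c) P R ↔ JohnsonAdj P.1 R.1 := by
  have hcard : P.1.card = R.1.card := P.2.trans R.2.symm
  constructor
  · rintro ⟨hne, -, hmax⟩
    have hne' : P.1 ≠ R.1 := fun h => hne (Subtype.ext h)
    obtain ⟨p, hp, hpR⟩ := exists_mem_notMem_of_card_eq hcard hne'
    obtain ⟨z, hz, hzP⟩ := exists_mem_notMem_of_card_eq hcard.symm hne'.symm
    refine johnsonAdj_of_subset_insert (y := z) hcard hne' ?_
    rw [subset_insert_iff_kneserRel hc]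
    intro Q hPQ hzQ
    -- The competitor is one exchange from `P` towards `R`; its union with `P` is `insert z P`,
    -- which lies in `P ∪ R`.
    refine hmax ⟨insert z (P.1.erase p), (card_insert_erase hp hzP).trans P.2⟩ ?_ ?_ Q hPQ ?_
    · intro e
      exact hzP (congrArg Subtype.val e ▸ Finset.mem_insert_self _ _)
    · intro Q hPQ hRQ
      refine Finset.disjoint_insert_left.2 ⟨Finset.disjoint_left.1 hRQ hz, ?_⟩
      exact Finset.disjoint_of_subset_left (Finset.erase_subset _ _) hPQ
    · refine Finset.disjoint_insert_left.2 ⟨hzQ, ?_⟩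
      exact Finset.disjoint_of_subset_left (Finset.erase_subset _ _) hPQ
  · intro h
    obtain ⟨p, hp, z, hz, hR⟩ := h.exists_eq
    have hzR : z ∈ R.1 := hR ▸ Finset.mem_insert_self _ _
    have hRP : R.1 ⊆ insert z P.1 := hR ▸ Finset.insert_subset_insert _ (Finset.erase_subset _ _)
    refine ⟨fun e => h.ne (congrArg Subtype.val e), ?_, ?_⟩
    · have hcard : c ≤ ((insert z P.1)ᶜ : Finset α).card := by
        rw [Finset.card_compl]
        have := Finset.card_insert_le z P.1
        have := P.2
        omega
      obtain ⟨Q, hQ, hQc⟩ := Finset.exists_subset_card_eq hcard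
      have hd : Disjoint (insert z P.1) Q :=
        Finset.disjoint_of_subset_right hQ disjoint_compl_right
      exact ⟨⟨Q, hQc⟩, Finset.disjoint_of_subset_left (Finset.subset_insert _ _) hd,
        Finset.disjoint_of_subset_left hRP hd⟩
    · intro w hw hsub Q hPQ hwQ
      have hwP : w.1 ⊆ insert z P.1 := by
        rw [subset_insert_iff_kneserRel hc]
        intro Q hPQ hzQ
        refine hsub Q hPQ ?_
        refine Finset.disjoint_of_subset_left hRP (Finset.disjoint_insert_left.2 ⟨hzQ, hPQ⟩)
      have hzw : z ∈ w.1 := by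
        obtain ⟨u, hu, huP⟩ := exists_mem_notMem_of_card_eq (w.2.trans P.2.symm)
          (fun e => hw (Subtype.ext e))
        exact (Finset.mem_insert.1 (hwP hu)).resolve_right huP ▸ hu
      exact Finset.disjoint_of_subset_left hRP
        (Finset.disjoint_insert_left.2 ⟨Finset.disjoint_left.1 hwQ hzw, hPQ⟩)

theorem subset_union_iff_kneserRel (hc : 2 * c < Fintype.card α)
    {P R : {P : Finset α // P.card = c}} (h : JohnsonAdj P.1 R.1)
    (S : {P : Finset α // P.card = c}) : S.1 ⊆ P.1 ∪ R.1 ↔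
      ∀ Q, kneserRel α c P Q → kneserRel α c R Q → kneserRel α c S Q := by
  obtain ⟨p, hp, z, hz, hR⟩ := h.exists_eq
  have hU : P.1 ∪ R.1 = insert z P.1 := by
    rw [hR]
    ext u
    simp only [Finset.mem_union, Finset.mem_insert, Finset.mem_erase]
    tauto
  rw [hU, subset_insert_iff_kneserRel hc]
  refine forall_congr' fun Q => forall_congr' fun hPQ => ?_
  have : kneserRel α c R Q ↔ z ∉ Q.1 := by
    unfold kneserRel
    rw [hR, Finset.disjoint_insert_left]
    exact ⟨fun h => h.1, fun h => ⟨h, Finset.disjoint_of_subset_left (Finset.erase_subset _ _) hPQ⟩⟩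
  rw [this]

/-- Automorphisms of the Kneser graph send stars over `(c - 1)`-sets to such stars. -/
theorem exists_star_image (hc : 2 * (c + 1) < Fintype.card α)
    (ψ : kneserRel α (c + 1) ≃r kneserRel α (c + 1)) (I : {I : Finset α // I.card = c}) :
    ∃ J : {I : Finset α // I.card = c}, ∀ P, I.1 ⊆ P.1 ↔ J.1 ⊆ (ψ P).1 := by
  have hI : 2 ≤ (I.1ᶜ : Finset α).card := by
    rw [Finset.card_compl, I.2]
    omega
  obtain ⟨s, hs, t, ht, hst⟩ := Finset.one_lt_card.1 hI
  rw [Finset.mem_compl] at hs ht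
  let P : {P : Finset α // P.card = c + 1} :=
    ⟨insert s I.1, by rw [Finset.card_insert_of_notMem hs, I.2]⟩
  let R : {P : Finset α // P.card = c + 1} :=
    ⟨insert t I.1, by rw [Finset.card_insert_of_notMem ht, I.2]⟩
  have hPR : JohnsonAdj P.1 R.1 := by
    refine johnsonAdj_of_subset_insert (y := t) (P.2.trans R.2.symm) ?_ ?_
    · intro (e : insert s I.1 = insert t I.1)
      have : s ∈ insert t I.1 := e ▸ Finset.mem_insert_self s I.1
      simp [hst, hs] at this
    · exact Finset.insert_subset_insert _ (Finset.subset_insert _ _)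
  have hint : P.1 ∩ R.1 = I.1 := by
    ext u
    simp only [P, R, Finset.mem_inter, Finset.mem_insert]
    constructor
    · rintro ⟨rfl | h1, rfl | h2⟩
      · exact absurd rfl hst
      · exact h2
      · exact h1
      · exact h1
    · tauto
  have hadj : ∀ P R, JohnsonAdj P.1 R.1 ↔ JohnsonAdj (ψ P).1 (ψ R).1 := fun P R => by
    rw [← isMaxPair_kneserRel_iff hc, ← isMaxPair_kneserRel_iff hc,
      isMaxPair_map_iff]
  have hPR' := (hadj P R).1 hPR
  -- Since `I = P ∩ R`, membership in the star over `I` is expressed through Johnson adjacency and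
  -- common neighbours of `P` and `R`; `ψ` respects both, so the image is the star over the
  -- intersection of the images.
  refine ⟨⟨(ψ P).1 ∩ (ψ R).1, ?_⟩, fun M => ?_⟩
  · have h1 := Finset.card_sdiff_add_card_inter (ψ P).1 (ψ R).1
    rw [hPR'.2, (ψ P).2] at h1
    omega
  · dsimp only
    rw [← hint, inter_subset_iff_of_johnsonAdj hPR (P.2.trans M.2.symm),
      inter_subset_iff_of_johnsonAdj hPR' ((ψ P).2.trans (ψ M).2.symm),
      subset_union_iff_kneserRel hc hPR, subset_union_iff_kneserRel hc hPR', ← hadj, ← hadj,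
      ← Subtype.ext_iff, ← Subtype.ext_iff, ← Subtype.ext_iff, ← Subtype.ext_iff,
      ψ.injective.eq_iff, ψ.injective.eq_iff]
    have hN : (∀ Q, kneserRel α (c + 1) P Q → kneserRel α (c + 1) R Q → kneserRel α (c + 1) M Q) ↔
        ∀ Q, kneserRel α (c + 1) (ψ P) Q → kneserRel α (c + 1) (ψ R) Q →
          kneserRel α (c + 1) (ψ M) Q := by
      refine ⟨fun h Q hP hR => ?_, fun h Q hP hR => ?_⟩
      · obtain ⟨Q, rfl⟩ := ψ.surjective Q
        exact ψ.map_rel_iff.2 (h Q (ψ.map_rel_iff.1 hP) (ψ.map_rel_iff.1 hR))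
      · exact ψ.map_rel_iff.1 (h (ψ Q) (ψ.map_rel_iff.2 hP) (ψ.map_rel_iff.2 hR))
    rw [hN]

theorem eq_of_forall_subset_iff (hc : c + 1 < Fintype.card α) {I J : {I : Finset α // I.card = c}}
    (h : ∀ P : {P : Finset α // P.card = c + 1}, I.1 ⊆ P.1 ↔ J.1 ⊆ P.1) : I = J := by
  have key : I.1 ⊆ J.1 := subset_of_forall_superset (W := Finset.univ) (k := c + 1)
    (Finset.subset_univ _) (J.2.le.trans (Nat.le_succ c)) (by rwa [Finset.card_univ])
    (fun Q hQ _ hQc => (h ⟨Q, hQc⟩).2 hQ)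
  exact Subtype.ext (Finset.eq_of_subset_of_card_le key (J.2.trans I.2.symm).le)

/-- Disjoint centres extend to disjoint `(c + 1)`-sets, as `2 * (c + 1)` points are available. The
images of these sets are disjoint and contain the new centres. This makes the action on centres a
Kneser automorphism, which drives the induction on `c`. -/
theorem disjoint_of_star_image (hc : 2 * (c + 1) < Fintype.card α)
    (ψ : kneserRel α (c + 1) ≃r kneserRel α (c + 1)) {I I' J J' : {I : Finset α // I.card = c}}
    (hJ : ∀ P, I.1 ⊆ P.1 ↔ J.1 ⊆ (ψ P).1) (hJ' : ∀ P, I'.1 ⊆ P.1 ↔ J'.1 ⊆ (ψ P).1)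
    (h : Disjoint I.1 I'.1) : Disjoint J.1 J'.1 := by
  obtain ⟨P, h1, h2, h3⟩ := Finset.exists_subsuperset_card_eq (n := c + 1)
    (Finset.subset_compl_iff_disjoint_right.2 h) (by rw [I.2]; omega)
    (by rw [Finset.card_compl, I'.2]; omega)
  obtain ⟨P', h1', h2', h3'⟩ := Finset.exists_subsuperset_card_eq (n := c + 1)
    (Finset.subset_compl_iff_disjoint_right.2 (Finset.subset_compl_iff_disjoint_right.1 h2).symm)
    (by rw [I'.2]; omega) (by rw [Finset.card_compl, h3]; omega)
  have hd : kneserRel α (c + 1) ⟨P, h3⟩ ⟨P', h3'⟩ :=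
    (Finset.subset_compl_iff_disjoint_right.1 h2').symm
  have hd' : Disjoint (ψ ⟨P, h3⟩).1 (ψ ⟨P', h3'⟩).1 := ψ.map_rel_iff.2 hd
  exact Finset.disjoint_of_subset_left ((hJ ⟨P, h3⟩).1 h1)
    (Finset.disjoint_of_subset_right ((hJ' ⟨P', h3'⟩).1 h1') hd')

/-- Every automorphism of a Kneser graph with `2 * c < #α` is induced by a permutation. -/
theorem exists_perm_of_kneserRel_iso (hc0 : 1 ≤ c) (hc : 2 * c < Fintype.card α)
    (ψ : kneserRel α c ≃r kneserRel α c) :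
    ∃ σ : Equiv.Perm α, ∀ P, (ψ P).1 = P.1.map σ.toEmbedding := by
  induction c, hc0 using Nat.le_induction with
  | base =>
    choose f hf using fun x : α => Finset.card_eq_one.1 (ψ ⟨{x}, Finset.card_singleton x⟩).2
    have hinj : Function.Injective f := fun x y hxy => by
      have h1 : ψ ⟨{x}, Finset.card_singleton x⟩ = ψ ⟨{y}, Finset.card_singleton y⟩ :=
        Subtype.ext (by rw [hf, hf, hxy])
      simpa using congrArg Subtype.val (ψ.injective h1)
    refine ⟨Equiv.ofBijective f (Finite.injective_iff_bijective.1 hinj), ?_⟩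
    rintro ⟨P, hP⟩
    obtain ⟨x, rfl⟩ := Finset.card_eq_one.1 hP
    rw [hf x]
    simp
  | succ c hc0 ih =>
    choose f hf using exists_star_image hc ψ
    choose g hg using exists_star_image hc ψ.symm
    have hgf : ∀ I, g (f I) = I := fun I => eq_of_forall_subset_iff (by omega) fun P => by
      rw [hf I P, hg (f I) (ψ P), ψ.symm_apply_apply]
    have hfg : ∀ I, f (g I) = I := fun I => eq_of_forall_subset_iff (by omega) fun P => by
      rw [hg I P, hf (g I) (ψ.symm P), ψ.apply_symm_apply]
    let ψ' : kneserRel α c ≃r kneserRel α c :=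
      { toFun := f
        invFun := g
        left_inv := hgf
        right_inv := hfg
        map_rel_iff' := by
          intro I I'
          refine ⟨fun h => ?_, fun h => disjoint_of_star_image hc ψ (hf I) (hf I') h⟩
          have := disjoint_of_star_image hc ψ.symm (hg (f I)) (hg (f I')) h
          rwa [hgf, hgf] at this }
    obtain ⟨σ, hσ⟩ := ih (by omega) ψ'
    refine ⟨σ, fun P => ?_⟩
    symm
    -- Each point of `P` lies in a `c`-subset `I` of `P`, and the centre of the image star, which is
    -- the image of `I` under `σ`, is contained in `ψ P`.
    refine Finset.eq_of_subset_of_card_le ?_ (by rw [Finset.card_map, P.2, (ψ P).2])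
    intro y hy
    obtain ⟨x, hx, rfl⟩ := Finset.mem_map.1 hy
    obtain ⟨I, h1, h2, h3⟩ := Finset.exists_subsuperset_card_eq (n := c)
      (Finset.singleton_subset_iff.2 hx) (by simpa using hc0) (by rw [P.2]; omega)
    have h4 : (f ⟨I, h3⟩).1 = I.map σ.toEmbedding := hσ ⟨I, h3⟩
    have h5 := (hf ⟨I, h3⟩ P).1 h2
    rw [h4] at h5
    exact h5 (Finset.mem_map_of_mem _ (h1 (Finset.mem_singleton_self x)))

end Kneser

/-! ### The graph on pairs of disjoint sets -/

section DisjointPair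

variable {α : Type*} {a c : ℕ}

/-- Ordered pairs of disjoint sets of sizes `a` and `c`. -/
@[ext]
structure DisjointPair (α : Type*) (a c : ℕ) where
  fst : Finset α
  snd : Finset α
  card_fst : fst.card = a
  card_snd : snd.card = c
  disjoint : Disjoint fst snd

/-- Two pairs of disjoint sets are related if the second members are disjoint and each of them
contains the first member of the other pair. -/
def pairRel (α : Type*) (a c : ℕ) (v u : DisjointPair α a c) : Prop :=
  v.fst ⊆ u.snd ∧ u.fst ⊆ v.snd ∧ Disjoint v.snd u.snd

/-- The action of a permutation on pairs of disjoint sets. -/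
def DisjointPair.map (σ : Equiv.Perm α) (v : DisjointPair α a c) : DisjointPair α a c where
  fst := v.fst.map σ.toEmbedding
  snd := v.snd.map σ.toEmbedding
  card_fst := by rw [Finset.card_map, v.card_fst]
  card_snd := by rw [Finset.card_map, v.card_snd]
  disjoint := (Finset.disjoint_map _).2 v.disjoint

theorem DisjointPair.map_map (σ τ : Equiv.Perm α) (v : DisjointPair α a c) :
    (v.map τ).map σ = v.map (σ * τ) := by
  ext x <;> simp only [DisjointPair.map, Finset.mem_map_equiv] <;> rfl

theorem DisjointPair.map_one (v : DisjointPair α a c) : v.map 1 = v := by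
  ext x <;> simp only [DisjointPair.map, Finset.mem_map_equiv] <;> rfl

/-- The action of permutations on pairs of disjoint sets, as automorphisms of `pairRel`. -/
def permToPairRelIso (α : Type*) (a c : ℕ) :
    Equiv.Perm α →* (pairRel α a c ≃r pairRel α a c) where
  toFun σ :=
    { toFun := DisjointPair.map σ
      invFun := DisjointPair.map σ⁻¹
      left_inv := fun v => by rw [DisjointPair.map_map, inv_mul_cancel, DisjointPair.map_one]
      right_inv := fun v => by rw [DisjointPair.map_map, mul_inv_cancel, DisjointPair.map_one]
      map_rel_iff' := by
        intro v u
        simp [pairRel, DisjointPair.map, Finset.map_subset_map, Finset.disjoint_map] }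
  map_one' := RelIso.ext fun v => DisjointPair.map_one v
  map_mul' σ τ := RelIso.ext fun v => (DisjointPair.map_map σ τ v).symm

variable [DecidableEq α]

/-- Exchange of one element of the first member. -/
def DisjointPair.exchangeFst (v : DisjointPair α a c) {x y : α} (hx : x ∈ v.fst) (hy : y ∉ v.fst)
    (hy' : y ∉ v.snd) : DisjointPair α a c where
  fst := insert y (v.fst.erase x)
  snd := v.snd
  card_fst := (card_insert_erase hx hy).trans v.card_fst
  card_snd := v.card_snd
  disjoint := Finset.disjoint_insert_left.2
    ⟨hy', Finset.disjoint_of_subset_left (Finset.erase_subset _ _) v.disjoint⟩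

/-- Exchange of one element of the second member. -/
def DisjointPair.exchangeSnd (v : DisjointPair α a c) {x y : α} (hx : x ∈ v.snd) (hy : y ∉ v.snd)
    (hy' : y ∉ v.fst) : DisjointPair α a c where
  fst := v.fst
  snd := insert y (v.snd.erase x)
  card_fst := v.card_fst
  card_snd := (card_insert_erase hx hy).trans v.card_snd
  disjoint := Finset.disjoint_insert_right.2
    ⟨hy', Finset.disjoint_of_subset_right (Finset.erase_subset _ _) v.disjoint⟩

theorem JohnsonAdj.card_inter {K L : Finset α} (h : JohnsonAdj K L) :
    (K ∩ L).card + 1 = K.card := by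
  have h1 := Finset.card_sdiff_add_card_inter K L
  have := h.2
  omega

theorem JohnsonAdj.card_union {K L : Finset α} (h : JohnsonAdj K L) :
    (K ∪ L).card = K.card + 1 := by
  have h1 := Finset.card_union_add_card_inter K L
  have := h.card_inter
  have := h.1
  omega

/-! ### Common neighbours and maximal pairs of disjoint pairs -/

variable [Fintype α]

theorem common_pairRel_iff {v w u : DisjointPair α a c} :
    pairRel α a c v u ∧ pairRel α a c w u ↔
      u.fst ⊆ v.snd ∩ w.snd ∧ v.fst ∪ w.fst ⊆ u.snd ∧ u.snd ⊆ (v.snd ∪ w.snd)ᶜ := by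
  unfold pairRel
  rw [Finset.subset_inter_iff, Finset.union_subset_iff, Finset.subset_compl_iff_disjoint_left,
    Finset.disjoint_union_left]
  tauto

/-- What it means for two pairs to have a common neighbour. -/
structure HasCommon (v w : DisjointPair α a c) : Prop where
  subset : v.fst ∪ w.fst ⊆ (v.snd ∪ w.snd)ᶜ
  le_inter : a ≤ (v.snd ∩ w.snd).card
  union_le : (v.fst ∪ w.fst).card ≤ c
  le_compl : c ≤ ((v.snd ∪ w.snd)ᶜ : Finset α).card

theorem hasCommon_iff {v w : DisjointPair α a c} :
    HasCommon v w ↔ ∃ u, pairRel α a c v u ∧ pairRel α a c w u := by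
  simp only [common_pairRel_iff]
  constructor
  · rintro ⟨h1, h2, h3, h4⟩
    obtain ⟨C, hC, hCa⟩ := Finset.exists_subset_card_eq h2
    obtain ⟨Q, hQ, hQ', hQc⟩ := Finset.exists_subsuperset_card_eq h1 h3 h4
    refine ⟨⟨C, Q, hCa, hQc, ?_⟩, hC, hQ, hQ'⟩
    refine Finset.disjoint_of_subset_left (hC.trans ?_)
      (Finset.disjoint_of_subset_right hQ' disjoint_compl_right)
    exact Finset.inter_subset_left.trans Finset.subset_union_left
  · rintro ⟨u, h1, h2, h3⟩
    exact ⟨h2.trans h3, u.card_fst.ge.trans (Finset.card_le_card h1),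
      (Finset.card_le_card h2).trans u.card_snd.le,
      u.card_snd.ge.trans (Finset.card_le_card h3)⟩

/-- For a common neighbour `u`, the sets `u.fst` and `u.snd` can be chosen independently. The
choices of `u.fst` cover `v.snd ∩ w.snd`. The strict inequalities are what leaves freedom in
`u.snd`: the first makes the choices intersect in `v.fst ∪ w.fst`, the second makes them cover the
complement of `v.snd ∪ w.snd`. -/
theorem HasCommon.of_forall (ha : 1 ≤ a) {v w t : DisjointPair α a c} (h : HasCommon v w)
    (ht : ∀ u, pairRel α a c v u → pairRel α a c w u → pairRel α a c t u) :
    v.snd ∩ w.snd ⊆ t.snd ∧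
      (c < ((v.snd ∪ w.snd)ᶜ : Finset α).card → t.fst ⊆ v.fst ∪ w.fst) ∧
      ((v.fst ∪ w.fst).card < c → t.snd ⊆ v.snd ∪ w.snd) := by
  have key : ∀ C Q : Finset α, C ⊆ v.snd ∩ w.snd → C.card = a → v.fst ∪ w.fst ⊆ Q →
      Q ⊆ (v.snd ∪ w.snd)ᶜ → Q.card = c → t.fst ⊆ Q ∧ C ⊆ t.snd ∧ Disjoint t.snd Q := by
    intro C Q hC hCa hQ hQ' hQc
    have hCQ : Disjoint C Q := Finset.disjoint_of_subset_left
      (hC.trans (Finset.inter_subset_left.trans Finset.subset_union_left))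
      (Finset.disjoint_of_subset_right hQ' disjoint_compl_right)
    have hu := common_pairRel_iff.2 (⟨hC, hQ, hQ'⟩ : (⟨C, Q, hCa, hQc, hCQ⟩ :
      DisjointPair α a c).fst ⊆ v.snd ∩ w.snd ∧ v.fst ∪ w.fst ⊆ Q ∧ Q ⊆ (v.snd ∪ w.snd)ᶜ)
    exact ht _ hu.1 hu.2
  obtain ⟨C₀, hC, hCa⟩ := Finset.exists_subset_card_eq h.le_inter
  obtain ⟨Q₀, hQ, hQ', hQc⟩ := Finset.exists_subsuperset_card_eq h.subset h.union_le h.le_compl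
  refine ⟨?_, fun hlt => ?_, fun hlt => ?_⟩
  · exact subset_of_forall_subset ha h.le_inter fun C h1 h2 => (key C Q₀ h1 h2 hQ hQ' hQc).2.1
  · exact subset_of_forall_superset h.subset h.union_le hlt
      fun Q h1 h2 h3 => (key C₀ Q hC hCa h1 h2 h3).1
  · exact disjoint_compl_right_iff.1 (disjoint_of_forall_superset h.subset hlt h.le_compl
      fun Q h1 h2 h3 => (key C₀ Q hC hCa h1 h2 h3).2.2)

/-- Pairs with equal second members and Johnson-adjacent first members. -/
def FstAdj (v w : DisjointPair α a c) : Prop :=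
  v.snd = w.snd ∧ JohnsonAdj v.fst w.fst

/-- Pairs with equal first members and Johnson-adjacent second members. -/
def SndAdj (v w : DisjointPair α a c) : Prop :=
  v.fst = w.fst ∧ JohnsonAdj v.snd w.snd

theorem FstAdj.hasCommon {v w : DisjointPair α a c} (hac : a < c) (hc : 2 * c < Fintype.card α)
    (h : FstAdj v w) : HasCommon v w := by
  obtain ⟨h1, h2⟩ := h
  refine ⟨?_, ?_, ?_, ?_⟩
  · rw [← h1, Finset.union_self, Finset.subset_compl_iff_disjoint_right, Finset.disjoint_union_left]
    exact ⟨v.disjoint, h1 ▸ w.disjoint⟩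
  · rw [← h1, Finset.inter_self, v.card_snd]
    exact hac.le
  · rw [h2.card_union, v.card_fst]
    exact hac
  · rw [← h1, Finset.union_self, Finset.card_compl, v.card_snd]
    omega

theorem SndAdj.hasCommon {v w : DisjointPair α a c} (hac : a < c) (hc : 2 * c < Fintype.card α)
    (h : SndAdj v w) : HasCommon v w := by
  obtain ⟨h1, h2⟩ := h
  refine ⟨?_, ?_, ?_, ?_⟩
  · rw [← h1, Finset.union_self, Finset.subset_compl_iff_disjoint_right,
      Finset.disjoint_union_right]
    exact ⟨v.disjoint, h1 ▸ w.disjoint⟩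
  · have := h2.card_inter
    rw [v.card_snd] at this
    omega
  · rw [← h1, Finset.union_self, v.card_fst]
    exact hac.le
  · rw [Finset.card_compl, h2.card_union, v.card_snd]
    omega

/-- A competitor `t` has the second member of `v`, and its first member lies in `v.fst ∪ w.fst`.
Being different from `v`, it contains the new element of `w.fst`, so a common neighbour of `v` and
`t` is also adjacent to `w`. -/
theorem FstAdj.isMaxPair {v w : DisjointPair α a c} (ha : 1 ≤ a) (hac : a < c)
    (hc : 2 * c < Fintype.card α) (h : FstAdj v w) : IsMaxPair (pairRel α a c) v w := by
  have hcom := h.hasCommon hac hc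
  obtain ⟨h1, h2⟩ := h
  refine ⟨fun e => h2.ne (congrArg _ e), hasCommon_iff.1 hcom, fun t ht hsub u hvu htu => ?_⟩
  obtain ⟨h3, h4, -⟩ := hcom.of_forall ha hsub
  rw [← h1, Finset.inter_self] at h3
  rw [← h1, Finset.union_self, Finset.card_compl, v.card_snd] at h4
  replace h4 := h4 (by omega)
  have h5 : v.snd = t.snd :=
    Finset.eq_of_subset_of_card_le h3 (t.card_snd.trans v.card_snd.symm).le
  have hne : t.fst ≠ v.fst := fun e => ht (DisjointPair.ext e h5.symm)
  refine ⟨?_, h1 ▸ hvu.2.1, h1 ▸ hvu.2.2⟩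
  obtain ⟨x, hx, y, hy, hw⟩ := h2.exists_eq
  have h6 : t.fst ⊆ insert y v.fst := fun z hz => by
    have := h4 hz
    rw [hw] at this
    simp only [Finset.mem_union, Finset.mem_insert, Finset.mem_erase] at this ⊢
    tauto
  obtain ⟨z, hz, hzv⟩ := exists_mem_notMem_of_card_eq (t.card_fst.trans v.card_fst.symm) hne
  have hzy : z = y := (Finset.mem_insert.1 (h6 hz)).resolve_right hzv
  rw [hw]
  exact Finset.insert_subset (htu.1 (hzy ▸ hz)) ((Finset.erase_subset _ _).trans hvu.1)

/-- The complement of `v.snd ∪ w.snd` has `Fintype.card α - c - 1` elements, which must exceed `c`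
to force `t.fst = v.fst`; hence the stronger bound. The competitor then equals `w`. -/
theorem SndAdj.isMaxPair {v w : DisjointPair α a c} (ha : 1 ≤ a) (hac : a < c)
    (hc : 2 * c + 2 ≤ Fintype.card α) (h : SndAdj v w) : IsMaxPair (pairRel α a c) v w := by
  have hcom := h.hasCommon hac (by omega)
  obtain ⟨h1, h2⟩ := h
  refine ⟨fun e => h2.ne (congrArg _ e), hasCommon_iff.1 hcom, fun t ht hsub u hvu htu => ?_⟩
  obtain ⟨h3, h4, h5⟩ := hcom.of_forall ha hsub
  rw [Finset.card_compl, h2.card_union, v.card_snd, ← h1, Finset.union_self] at h4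
  rw [← h1, Finset.union_self, v.card_fst] at h5
  replace h4 := h4 (by omega)
  replace h5 := h5 hac
  have h6 : t.fst = v.fst :=
    Finset.eq_of_subset_of_card_le h4 (t.card_fst.trans v.card_fst.symm).ge
  have hne : t.snd ≠ v.snd := fun e => ht (DisjointPair.ext h6 e)
  obtain ⟨x, hx, y, hy, hw⟩ := h2.exists_eq
  obtain ⟨z, hz, hzv⟩ := exists_mem_notMem_of_card_eq (t.card_snd.trans v.card_snd.symm) hne
  have hzy : z = y := by
    have := h5 hz
    rw [hw] at this
    simp only [Finset.mem_union, Finset.mem_insert, Finset.mem_erase] at this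
    tauto
  subst hzy
  have hwt : w.snd ⊆ t.snd := fun u hu => by
    have hu' := hu
    rw [hw, Finset.mem_insert, Finset.mem_erase] at hu'
    rcases hu' with rfl | hu'
    · exact hz
    · exact h3 (Finset.mem_inter.2 ⟨hu'.2, hu⟩)
  have : w = t := DisjointPair.ext (h1.symm.trans h6.symm)
    (Finset.eq_of_subset_of_card_le hwt (t.card_snd.trans w.card_snd.symm).le)
  exact this ▸ htu

/-- One exchange from `v.fst` towards `w.fst`, with `v.snd` kept, loses no common neighbour.
Maximality then confines `w` to what the exchanged vertex allows. The exchange is legitimate because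
the incoming element lies in the second member of a common neighbour, hence outside `v.snd`. -/
theorem IsMaxPair.fstAdj {v w : DisjointPair α a c} (ha : 1 ≤ a) (hac : a < c)
    (hc : 2 * c < Fintype.card α) (h : IsMaxPair (pairRel α a c) v w) (hne : v.fst ≠ w.fst) :
    FstAdj v w := by
  obtain ⟨-, ⟨u, hvu, hwu⟩, hmax⟩ := h
  obtain ⟨x, hx, hxw⟩ := exists_mem_notMem_of_card_eq (v.card_fst.trans w.card_fst.symm) hne
  obtain ⟨y, hy, hyv⟩ := exists_mem_notMem_of_card_eq (w.card_fst.trans v.card_fst.symm) hne.symm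
  have hyv' : y ∉ v.snd := Finset.disjoint_right.1 hvu.2.2 (hwu.1 hy)
  let t := v.exchangeFst hx hyv hyv'
  have hvt : FstAdj v t := ⟨rfl, johnsonAdj_insert_erase hx hyv⟩
  have := hmax t (fun e => hvt.2.ne (congrArg _ e.symm)) fun u hvu hwu =>
    ⟨Finset.insert_subset (hwu.1 hy) ((Finset.erase_subset _ _).trans hvu.1), hvu.2⟩
  obtain ⟨h1, h2, -⟩ := (hvt.hasCommon hac hc).of_forall ha this
  rw [← hvt.1, Finset.inter_self] at h1
  rw [← hvt.1, Finset.union_self, Finset.card_compl, v.card_snd] at h2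
  replace h2 := h2 (by omega)
  refine ⟨Finset.eq_of_subset_of_card_le h1 (w.card_snd.trans v.card_snd.symm).le,
    johnsonAdj_of_subset_insert (y := y) (v.card_fst.trans w.card_fst.symm) hne (h2.trans ?_)⟩
  exact Finset.union_subset (Finset.subset_insert _ _)
    (Finset.insert_subset_insert _ (Finset.erase_subset _ _))

theorem IsMaxPair.sndAdj {v w : DisjointPair α a c} (ha : 1 ≤ a) (hac : a < c)
    (hc : 2 * c < Fintype.card α) (h : IsMaxPair (pairRel α a c) v w) (heq : v.fst = w.fst) :
    SndAdj v w := by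
  obtain ⟨hvw, -, hmax⟩ := h
  have hne : v.snd ≠ w.snd := fun e => hvw (DisjointPair.ext heq e)
  obtain ⟨x, hx, hxw⟩ := exists_mem_notMem_of_card_eq (v.card_snd.trans w.card_snd.symm) hne
  obtain ⟨y, hy, hyv⟩ := exists_mem_notMem_of_card_eq (w.card_snd.trans v.card_snd.symm) hne.symm
  have hyv' : y ∉ v.fst := heq ▸ Finset.disjoint_right.1 w.disjoint hy
  let t := v.exchangeSnd hx hyv hyv'
  have hvt : SndAdj v t := ⟨rfl, johnsonAdj_insert_erase hx hyv⟩
  have := hmax t (fun e => hvt.2.ne (congrArg _ e.symm)) fun u hvu hwu => by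
    obtain ⟨h1, h2, h3⟩ := common_pairRel_iff.1 ⟨hvu, hwu⟩
    refine ⟨hvu.1, fun z hz => ?_, ?_⟩
    · have hz1 := hvu.2.1 hz
      have hz2 := hwu.2.1 hz
      exact Finset.mem_insert_of_mem (Finset.mem_erase.2 ⟨fun e => hxw (e ▸ hz2), hz1⟩)
    · exact Finset.disjoint_insert_left.2 ⟨Finset.disjoint_left.1 hwu.2.2 hy,
        Finset.disjoint_of_subset_left (Finset.erase_subset _ _) hvu.2.2⟩
  obtain ⟨h1, -, -⟩ := (hvt.hasCommon hac hc).of_forall ha this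
  refine ⟨heq, johnsonAdj_of_erase_subset hx (v.card_snd.trans w.card_snd.symm) hne
    (Finset.Subset.trans ?_ h1)⟩
  exact Finset.subset_inter (Finset.erase_subset _ _) (Finset.subset_insert _ _)

/-- With equal first members, `v.snd ∪ w.snd` has `c + 1` elements and its complement exactly `c`,
so all common neighbours share one second member. As `a < c`, it contains some `y` outside `v.fst`;
exchanging `y` into `v.fst` keeps all these neighbours, and maximality would force `v.snd = w.snd`.
-/
theorem IsMaxPair.fst_ne {v w : DisjointPair α a c} (ha : 1 ≤ a) (hac : a < c)
    (hc : 2 * c + 1 = Fintype.card α) (h : IsMaxPair (pairRel α a c) v w) : v.fst ≠ w.fst := by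
  intro heq
  have hs := h.sndAdj ha hac (by omega) heq
  obtain ⟨-, ⟨u, hvu, hwu⟩, hmax⟩ := h
  have hW : ((v.snd ∪ w.snd)ᶜ : Finset α).card = c := by
    rw [Finset.card_compl, hs.2.card_union, v.card_snd]
    omega
  have hW' : ∀ u, pairRel α a c v u → pairRel α a c w u → u.snd = (v.snd ∪ w.snd)ᶜ :=
    fun u hvu hwu => Finset.eq_of_subset_of_card_le (common_pairRel_iff.1 ⟨hvu, hwu⟩).2.2
      (hW.trans u.card_snd.symm).le
  obtain ⟨x, hx⟩ := Finset.card_pos.1 (show 0 < v.fst.card by rw [v.card_fst]; omega)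
  obtain ⟨y, hy, hyv⟩ := Finset.exists_mem_notMem_of_card_lt_card
    (show v.fst.card < u.snd.card by rw [v.card_fst, u.card_snd]; exact hac)
  have hyv' : y ∉ v.snd := Finset.disjoint_right.1 hvu.2.2 hy
  let t := v.exchangeFst hx hyv hyv'
  have hvt : FstAdj v t := ⟨rfl, johnsonAdj_insert_erase hx hyv⟩
  have := hmax t (fun e => hvt.2.ne (congrArg _ e.symm)) fun u' hvu' hwu' => by
    have hyu : y ∈ u'.snd := by
      rw [hW' u' hvu' hwu', ← hW' u hvu hwu]
      exact hy
    exact ⟨Finset.insert_subset hyu ((Finset.erase_subset _ _).trans hvu'.1), hvu'.2⟩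
  obtain ⟨h1, -, -⟩ := (hvt.hasCommon hac (by omega)).of_forall ha this
  rw [← hvt.1, Finset.inter_self] at h1
  exact hs.2.ne (Finset.eq_of_subset_of_card_le h1 (w.card_snd.trans v.card_snd.symm).le)

/-! ### Telling the two kinds of exchange apart -/

theorem isMaxPair_pairRel_iff {v w : DisjointPair α a c} (ha : 1 ≤ a) (hac : a < c)
    (hc : 2 * c + 2 ≤ Fintype.card α) :
    IsMaxPair (pairRel α a c) v w ↔ FstAdj v w ∨ SndAdj v w := by
  constructor
  · intro h
    by_cases heq : v.fst = w.fst
    · exact Or.inr (h.sndAdj ha hac (by omega) heq)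
    · exact Or.inl (h.fstAdj ha hac (by omega) heq)
  · rintro (h | h)
    · exact h.isMaxPair ha hac (by omega)
    · exact h.isMaxPair ha hac hc

/-- A triangle cannot mix the two kinds of exchange, so the count takes place in the Johnson graph
on the subsets of `v.sndᶜ`, a set of `Fintype.card α - c` elements. -/
theorem FstAdj.codegree {v w : DisjointPair α a c} (ha : 1 ≤ a) (hac : a < c)
    (hc : 2 * c + 2 ≤ Fintype.card α) (h : FstAdj v w) :
    maxPairCodegree (pairRel α a c) v w = Fintype.card α - c - 2 := by
  have hset : ∀ u, IsMaxPair (pairRel α a c) v u ∧ IsMaxPair (pairRel α a c) w u ↔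
      u.snd = v.snd ∧ JohnsonAdj v.fst u.fst ∧ JohnsonAdj w.fst u.fst := by
    intro u
    rw [isMaxPair_pairRel_iff ha hac hc, isMaxPair_pairRel_iff ha hac hc]
    constructor
    · rintro ⟨h1 | h1, h2 | h2⟩
      · exact ⟨h1.1.symm, h1.2, h2.2⟩
      · exact absurd (h.1.symm.trans h1.1) h2.2.ne
      · exact absurd (h.1.trans h2.1) h1.2.ne
      · exact absurd (h1.1.trans h2.1.symm) h.2.ne
    · rintro ⟨h1, h2, h3⟩
      exact ⟨Or.inl ⟨h1.symm, h2⟩, Or.inl ⟨h.1.symm.trans h1.symm, h3⟩⟩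
  have hinj : Set.InjOn DisjointPair.fst
      {u | IsMaxPair (pairRel α a c) v u ∧ IsMaxPair (pairRel α a c) w u} :=
    fun u hu u' hu' e =>
      DisjointPair.ext e (((hset u).1 hu).1.trans ((hset u').1 hu').1.symm)
  unfold maxPairCodegree
  rw [← hinj.ncard_image]
  have hv : v.fst ⊆ v.sndᶜ := Finset.subset_compl_iff_disjoint_right.2 v.disjoint
  have hw : w.fst ⊆ v.sndᶜ := Finset.subset_compl_iff_disjoint_right.2 (h.1 ▸ w.disjoint)
  have hcount := card_johnsonAdj_common hv hw h.2
  rw [Finset.card_compl, v.card_snd] at hcount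
  rw [← hcount, ← Set.ncard_coe_finset]
  congr 1
  ext M
  simp only [Set.mem_image, Finset.mem_coe, Finset.mem_filter, Finset.mem_powerset]
  constructor
  · rintro ⟨u, hu, rfl⟩
    obtain ⟨h1, h2⟩ := (hset u).1 hu
    exact ⟨Finset.subset_compl_iff_disjoint_right.2 (h1 ▸ u.disjoint), h2⟩
  · rintro ⟨h1, h2⟩
    exact ⟨⟨M, v.snd, h2.1.1.symm.trans v.card_fst, v.card_snd,
      Finset.subset_compl_iff_disjoint_right.1 h1⟩, (hset _).2 ⟨rfl, h2⟩, rfl⟩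

theorem SndAdj.codegree {v w : DisjointPair α a c} (ha : 1 ≤ a) (hac : a < c)
    (hc : 2 * c + 2 ≤ Fintype.card α) (h : SndAdj v w) :
    maxPairCodegree (pairRel α a c) v w = Fintype.card α - a - 2 := by
  have hset : ∀ u, IsMaxPair (pairRel α a c) v u ∧ IsMaxPair (pairRel α a c) w u ↔
      u.fst = v.fst ∧ JohnsonAdj v.snd u.snd ∧ JohnsonAdj w.snd u.snd := by
    intro u
    rw [isMaxPair_pairRel_iff ha hac hc, isMaxPair_pairRel_iff ha hac hc]
    constructor
    · rintro ⟨h1 | h1, h2 | h2⟩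
      · exact absurd (h1.1.trans h2.1.symm) h.2.ne
      · exact absurd (h.1.trans h2.1) h1.2.ne
      · exact absurd (h.1.symm.trans h1.1) h2.2.ne
      · exact ⟨h1.1.symm, h1.2, h2.2⟩
    · rintro ⟨h1, h2, h3⟩
      exact ⟨Or.inr ⟨h1.symm, h2⟩, Or.inr ⟨h.1.symm.trans h1.symm, h3⟩⟩
  have hinj : Set.InjOn DisjointPair.snd
      {u | IsMaxPair (pairRel α a c) v u ∧ IsMaxPair (pairRel α a c) w u} :=
    fun u hu u' hu' e =>
      DisjointPair.ext (((hset u).1 hu).1.trans ((hset u').1 hu').1.symm) e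
  unfold maxPairCodegree
  rw [← hinj.ncard_image]
  have hv : v.snd ⊆ v.fstᶜ := Finset.subset_compl_iff_disjoint_left.2 v.disjoint
  have hw : w.snd ⊆ v.fstᶜ := Finset.subset_compl_iff_disjoint_left.2 (h.1 ▸ w.disjoint)
  have hcount := card_johnsonAdj_common hv hw h.2
  rw [Finset.card_compl, v.card_fst] at hcount
  rw [← hcount, ← Set.ncard_coe_finset]
  congr 1
  ext M
  simp only [Set.mem_image, Finset.mem_coe, Finset.mem_filter, Finset.mem_powerset]
  constructor
  · rintro ⟨u, hu, rfl⟩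
    obtain ⟨h1, h2⟩ := (hset u).1 hu
    exact ⟨Finset.subset_compl_iff_disjoint_left.2 (h1 ▸ u.disjoint), h2⟩
  · rintro ⟨h1, h2⟩
    exact ⟨⟨v.fst, M, v.card_fst, h2.1.1.symm.trans v.card_snd,
      Finset.subset_compl_iff_disjoint_left.1 h1⟩, (hset _).2 ⟨rfl, h2⟩, rfl⟩

/-- The right-hand side is invariant under automorphisms. Away from `2 * c + 1 = Fintype.card α` the
two codegrees differ because `a < c`. -/
theorem fstAdj_iff {v w : DisjointPair α a c} (ha : 1 ≤ a) (hac : a < c)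
    (hc : 2 * c < Fintype.card α) :
    FstAdj v w ↔ IsMaxPair (pairRel α a c) v w ∧ (2 * c + 1 = Fintype.card α ∨
      maxPairCodegree (pairRel α a c) v w = Fintype.card α - c - 2) := by
  constructor
  · intro h
    refine ⟨h.isMaxPair ha hac hc, ?_⟩
    by_cases hc' : 2 * c + 1 = Fintype.card α
    · exact Or.inl hc'
    · exact Or.inr (h.codegree ha hac (by omega))
  · rintro ⟨h1, h2⟩
    refine h1.fstAdj ha hac hc ?_
    by_cases hc' : 2 * c + 1 = Fintype.card α
    · exact h1.fst_ne ha hac hc'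
    · intro heq
      have := (h1.sndAdj ha hac hc heq).codegree ha hac (by omega)
      omega

theorem FstAdj.map {v w : DisjointPair α a c} (ha : 1 ≤ a) (hac : a < c)
    (hc : 2 * c < Fintype.card α) (φ : pairRel α a c ≃r pairRel α a c) (h : FstAdj v w) :
    FstAdj (φ v) (φ w) := by
  rw [fstAdj_iff ha hac hc] at h ⊢
  rwa [isMaxPair_map_iff, maxPairCodegree_map]

/-- With the second member fixed, exchanges in the first member connect any two vertices; the
induction is on the number of exchanges needed. -/
theorem snd_eq_of_snd_eq (ha : 1 ≤ a) (hac : a < c) (hc : 2 * c < Fintype.card α)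
    (φ : pairRel α a c ≃r pairRel α a c) {v w : DisjointPair α a c} (h : v.snd = w.snd) :
    (φ v).snd = (φ w).snd := by
  induction hk : (w.fst \ v.fst).card generalizing v with
  | zero =>
    have : w.fst ⊆ v.fst := Finset.sdiff_eq_empty_iff_subset.1 (Finset.card_eq_zero.1 hk)
    have : v = w := DisjointPair.ext
      (Finset.eq_of_subset_of_card_le this (v.card_fst.trans w.card_fst.symm).le).symm h
    rw [this]
  | succ k ih =>
    have hne : v.fst ≠ w.fst := fun e => by simp [e] at hk
    obtain ⟨x, hx, hxw⟩ := exists_mem_notMem_of_card_eq (v.card_fst.trans w.card_fst.symm) hne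
    obtain ⟨y, hy, hyv⟩ :=
      exists_mem_notMem_of_card_eq (w.card_fst.trans v.card_fst.symm) hne.symm
    have hyv' : y ∉ v.snd := h ▸ Finset.disjoint_left.1 w.disjoint hy
    let t := v.exchangeFst hx hyv hyv'
    have hvt : FstAdj v t := ⟨rfl, johnsonAdj_insert_erase hx hyv⟩
    rw [(hvt.map ha hac hc φ).1]
    refine ih (v := t) h ?_
    have : w.fst \ t.fst = (w.fst \ v.fst).erase y := by
      ext z
      simp only [t, DisjointPair.exchangeFst, Finset.mem_sdiff, Finset.mem_insert,
        Finset.mem_erase]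
      have : z = x → z ∉ w.fst := fun e => e ▸ hxw
      tauto
    rw [this, Finset.card_erase_of_mem (Finset.mem_sdiff.2 ⟨hy, hyv⟩), hk]
    rfl

/-! ### Reduction to the Kneser graph -/

theorem exists_disjointPair (hac : a < c) (hc : 2 * c < Fintype.card α) (P : Finset α)
    (hP : P.card = c) : ∃ v : DisjointPair α a c, v.snd = P := by
  obtain ⟨A, hA, hAa⟩ := Finset.exists_subset_card_eq
    (show a ≤ (Pᶜ : Finset α).card by rw [Finset.card_compl, hP]; omega)
  exact ⟨⟨A, P, hAa, hP, Finset.subset_compl_iff_disjoint_right.1 hA⟩, rfl⟩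

theorem exists_kneser_map (ha : 1 ≤ a) (hac : a < c) (hc : 2 * c < Fintype.card α)
    (φ : pairRel α a c ≃r pairRel α a c) :
    ∃ f : {P : Finset α // P.card = c} → {P : Finset α // P.card = c},
      (∀ v : DisjointPair α a c, (f ⟨v.snd, v.card_snd⟩).1 = (φ v).snd) ∧
      ∀ P Q, kneserRel α c P Q → kneserRel α c (f P) (f Q) := by
  choose g hg using exists_disjointPair (α := α) hac hc
  have hf : ∀ v : DisjointPair α a c, (φ (g v.snd v.card_snd)).snd = (φ v).snd := fun v =>
    snd_eq_of_snd_eq ha hac hc φ (hg v.snd v.card_snd)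
  refine ⟨fun P => ⟨(φ (g P.1 P.2)).snd, (φ (g P.1 P.2)).card_snd⟩, hf, ?_⟩
  rintro ⟨P, hP⟩ ⟨Q, hQ⟩ (hPQ : Disjoint P Q)
  -- Disjoint `c`-sets are the second members of two adjacent vertices: each first member is taken
  -- inside the opposite second member, which is possible as `a < c`.
  obtain ⟨C, hC, hCa⟩ := Finset.exists_subset_card_eq (show a ≤ P.card by omega)
  obtain ⟨A, hA, hAa⟩ := Finset.exists_subset_card_eq (show a ≤ Q.card by omega)
  let v : DisjointPair α a c := ⟨A, P, hAa, hP, Finset.disjoint_of_subset_left hA hPQ.symm⟩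
  let u : DisjointPair α a c := ⟨C, Q, hCa, hQ, Finset.disjoint_of_subset_left hC hPQ⟩
  have hvu : pairRel α a c v u := ⟨hA, hC, hPQ⟩
  have := (φ.map_rel_iff.2 hvu).2.2
  rw [← hf v, ← hf u] at this
  exact this

theorem exists_perm_snd (ha : 1 ≤ a) (hac : a < c) (hc : 2 * c < Fintype.card α)
    (φ : pairRel α a c ≃r pairRel α a c) :
    ∃ σ : Equiv.Perm α, ∀ v, (φ v).snd = v.snd.map σ.toEmbedding := by
  obtain ⟨f, hf, hf'⟩ := exists_kneser_map ha hac hc φ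
  obtain ⟨g, hg, hg'⟩ := exists_kneser_map ha hac hc φ.symm
  have hgf : ∀ P, g (f P) = P := by
    rintro ⟨P, hP⟩
    obtain ⟨v, rfl⟩ := exists_disjointPair hac hc P hP
    have h1 : f ⟨v.snd, hP⟩ = ⟨(φ v).snd, (φ v).card_snd⟩ := Subtype.ext (hf v)
    refine Subtype.ext ?_
    rw [h1, hg (φ v), φ.symm_apply_apply]
  have hfg : ∀ P, f (g P) = P := by
    rintro ⟨P, hP⟩
    obtain ⟨v, rfl⟩ := exists_disjointPair hac hc P hP
    have h1 : g ⟨v.snd, hP⟩ = ⟨(φ.symm v).snd, (φ.symm v).card_snd⟩ := Subtype.ext (hg v)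
    refine Subtype.ext ?_
    rw [h1, hf (φ.symm v), φ.apply_symm_apply]
  let ψ : kneserRel α c ≃r kneserRel α c :=
    { toFun := f
      invFun := g
      left_inv := hgf
      right_inv := hfg
      map_rel_iff' := by
        intro P Q
        refine ⟨fun h => ?_, hf' P Q⟩
        have := hg' _ _ h
        rwa [Equiv.coe_fn_mk, hgf, hgf] at this }
  obtain ⟨σ, hσ⟩ := exists_perm_of_kneserRel_iso (by omega) hc ψ
  exact ⟨σ, fun v => (hf v).symm.trans (hσ ⟨v.snd, v.card_snd⟩)⟩

/-- The second members of the neighbours of `v` are all the `c`-sets between `v.fst` and `v.sndᶜ`.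
They intersect in `v.fst` since `c` is less than the size of `v.sndᶜ`, and they also contain the
first member of `φ v`. -/
theorem eq_self_of_snd_eq (hac : a < c) (hc : 2 * c < Fintype.card α)
    (φ : pairRel α a c ≃r pairRel α a c) (h : ∀ v, (φ v).snd = v.snd) (v : DisjointPair α a c) :
    φ v = v := by
  refine DisjointPair.ext (Finset.eq_of_subset_of_card_le ?_
    (v.card_fst.trans (φ v).card_fst.symm).le) (h v)
  refine subset_of_forall_superset (W := v.sndᶜ) (k := c)
    (Finset.subset_compl_iff_disjoint_right.2 v.disjoint) (v.card_fst.le.trans hac.le)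
    (by rw [Finset.card_compl, v.card_snd]; omega) fun Q h1 h2 h3 => ?_
  obtain ⟨C, hC, hCa⟩ := Finset.exists_subset_card_eq
    (show a ≤ v.snd.card by rw [v.card_snd]; exact hac.le)
  have hd : Disjoint v.snd Q := Finset.subset_compl_iff_disjoint_left.1 h2
  let u : DisjointPair α a c := ⟨C, Q, hCa, h3, Finset.disjoint_of_subset_left hC hd⟩
  have hvu : pairRel α a c v u := ⟨h1, hC, hd⟩
  have := (φ.map_rel_iff.2 hvu).1
  rwa [h u] at this

theorem permToPairRelIso_injective (hac : a < c) (hc : 2 * c < Fintype.card α) :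
    Function.Injective (permToPairRelIso α a c) := by
  rw [injective_iff_map_eq_one]
  intro σ hσ
  ext x
  by_contra hx
  -- A `c`-set containing `x` but not `σ x` cannot be fixed by `σ`.
  obtain ⟨P, h1, h2, h3⟩ := Finset.exists_subsuperset_card_eq (n := c)
    (s := {x}) (t := Finset.univ.erase (σ x)) (by simpa using Ne.symm hx)
    (by rw [Finset.card_singleton]; omega)
    (by rw [Finset.card_erase_of_mem (Finset.mem_univ _), Finset.card_univ]; omega)
  obtain ⟨v, rfl⟩ := exists_disjointPair hac hc P h3
  have h4 : v.snd.map σ.toEmbedding = v.snd :=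
    congrArg DisjointPair.snd (DFunLike.congr_fun hσ v)
  have h5 : σ x ∈ v.snd.map σ.toEmbedding :=
    Finset.mem_map_of_mem σ.toEmbedding (h1 (Finset.mem_singleton_self x))
  rw [h4] at h5
  simpa using h2 h5

theorem permToPairRelIso_surjective (ha : 1 ≤ a) (hac : a < c) (hc : 2 * c < Fintype.card α) :
    Function.Surjective (permToPairRelIso α a c) := by
  intro φ
  obtain ⟨σ, hσ⟩ := exists_perm_snd ha hac hc φ
  refine ⟨σ, ?_⟩
  have key := eq_self_of_snd_eq hac hc ((permToPairRelIso α a c σ⁻¹) * φ) fun v => by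
    change (φ v).snd.map (σ⁻¹).toEmbedding = v.snd
    rw [hσ]
    ext z
    simp only [Finset.mem_map_equiv]
    change σ.symm (σ z) ∈ v.snd ↔ z ∈ v.snd
    rw [Equiv.symm_apply_apply]
  have h1 : permToPairRelIso α a c σ⁻¹ * φ = 1 := RelIso.ext key
  rw [map_inv] at h1
  exact inv_mul_eq_one.1 h1

/-- The automorphism group of `pairRel` is the symmetric group. -/
noncomputable def permEquivPairRelIso (ha : 1 ≤ a) (hac : a < c) (hc : 2 * c < Fintype.card α) :
    Equiv.Perm α ≃* (pairRel α a c ≃r pairRel α a c) :=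
  MulEquiv.ofBijective (permToPairRelIso α a c)
    ⟨permToPairRelIso_injective hac hc, permToPairRelIso_surjective ha hac hc⟩

end DisjointPair

/-! ### From flags to pairs of disjoint sets -/

section Flags

variable {V W : Type*} {r : V → V → Prop} {s : W → W → Prop}

/-- Isomorphic relations have isomorphic automorphism groups. -/
def RelIso.autMulEquiv (e : r ≃r s) : (r ≃r r) ≃* (s ≃r s) where
  toFun φ := (e.symm.trans φ).trans e
  invFun φ := (e.trans φ).trans e.symm
  left_inv φ := RelIso.ext fun v => by simp
  right_inv φ := RelIso.ext fun v => by simp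
  map_mul' φ θ := RelIso.ext fun v => by simp [RelIso.mul_apply]

/-- Exchange of the two members of a pair of disjoint sets. -/
def DisjointPair.swap {α : Type*} {a c : ℕ} : DisjointPair α a c ≃ DisjointPair α c a where
  toFun v := ⟨v.snd, v.fst, v.card_snd, v.card_fst, v.disjoint.symm⟩
  invFun v := ⟨v.snd, v.fst, v.card_snd, v.card_fst, v.disjoint.symm⟩
  left_inv _ := rfl
  right_inv _ := rfl

variable {n a b : ℕ}

theorem DisjointPair.card_compl_snd (hb : b ≤ n) (v : DisjointPair (Fin n) a (n - b)) :
    (v.sndᶜ).card = b := by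
  rw [Finset.card_compl, v.card_snd, Fintype.card_fin]
  omega

/-- A pair `(U, V)` of disjoint sets gives the flag `{U, Vᶜ}`. -/
def DisjointPair.toFlag (ha : 1 ≤ a) (hab : a < b) (hb : b < n)
    (v : DisjointPair (Fin n) a (n - b)) : FlagOfType n {a, b} := by
  refine ⟨{v.fst, v.sndᶜ}, ⟨?_, ?_⟩, ?_⟩
  · have key : ∀ X : Finset (Fin n), 1 ≤ X.card → X.card < n → X.Nonempty ∧ X ≠ Finset.univ :=
      fun X h1 h2 => ⟨Finset.card_pos.1 h1, fun e => by simp [e] at h2⟩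
    have h1 := v.card_fst
    have h2 := v.card_compl_snd hb.le
    intro X hX
    rcases Finset.mem_insert.1 hX with rfl | hX
    · exact key _ (by omega) (by omega)
    · rw [Finset.mem_singleton.1 hX]
      exact key _ (by omega) (by omega)
  · have h : v.fst ⊆ v.sndᶜ := Finset.subset_compl_iff_disjoint_right.2 v.disjoint
    intro X hX Y hY
    rw [Finset.mem_insert, Finset.mem_singleton] at hX hY
    rcases hX with rfl | rfl <;> rcases hY with rfl | rfl
    · exact Or.inl subset_rfl
    · exact Or.inl h
    · exact Or.inr h
    · exact Or.inl subset_rfl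
  · unfold flagType
    rw [Finset.image_insert, Finset.image_singleton, v.card_fst, v.card_compl_snd hb.le]

/-- A chain has at most one member of each size, and `a ≠ b` decides which member is which. -/
theorem DisjointPair.toFlag_bijective (ha : 1 ≤ a) (hab : a < b) (hb : b < n) :
    Function.Bijective (DisjointPair.toFlag ha hab hb) := by
  constructor
  · intro v w h
    have h' : ({v.fst, v.sndᶜ} : Finset (Finset (Fin n))) = {w.fst, w.sndᶜ} :=
      congrArg Subtype.val h
    have hv := v.card_compl_snd hb.le
    have hw := w.card_compl_snd hb.le
    have h1 : v.fst ∈ ({w.fst, w.sndᶜ} : Finset (Finset (Fin n))) := h' ▸ by simp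
    have h2 : v.sndᶜ ∈ ({w.fst, w.sndᶜ} : Finset (Finset (Fin n))) := h' ▸ by simp
    rw [Finset.mem_insert, Finset.mem_singleton] at h1 h2
    have h3 := v.card_fst
    have h4 := w.card_fst
    refine DisjointPair.ext (h1.resolve_right fun e => ?_)
      (compl_injective (h2.resolve_left fun e => ?_))
    · rw [e] at h3
      omega
    · rw [e] at hv
      omega
  · rintro ⟨f, ⟨hf1, hf2⟩, hf3⟩
    have hmem : ∀ k, k ∈ ({a, b} : Finset ℕ) ↔ ∃ X ∈ f, X.card = k := fun k => by
      rw [← hf3]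
      exact Finset.mem_image
    obtain ⟨A, hA, hAa⟩ := (hmem a).1 (by simp)
    obtain ⟨B, hB, hBb⟩ := (hmem b).1 (by simp)
    have huniq : ∀ X ∈ f, ∀ Y ∈ f, X.card = Y.card → X = Y := fun X hX Y hY e => by
      rcases hf2 X hX Y hY with h | h
      · exact Finset.eq_of_subset_of_card_le h e.ge
      · exact (Finset.eq_of_subset_of_card_le h e.le).symm
    have hAB : A ⊆ B := by
      rcases hf2 A hA B hB with h | h
      · exact h
      · have := Finset.card_le_card h
        omega
    refine ⟨⟨A, Bᶜ, hAa, by rw [Finset.card_compl, hBb, Fintype.card_fin],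
      Finset.subset_compl_iff_disjoint_right.1 (by rwa [compl_compl])⟩, Subtype.ext ?_⟩
    change ({A, Bᶜᶜ} : Finset (Finset (Fin n))) = f
    rw [compl_compl]
    ext X
    rw [Finset.mem_insert, Finset.mem_singleton]
    constructor
    · rintro (rfl | rfl)
      · exact hA
      · exact hB
    · intro hX
      have : X.card ∈ ({a, b} : Finset ℕ) := (hmem _).2 ⟨X, hX, rfl⟩
      rw [Finset.mem_insert, Finset.mem_singleton] at this
      exact this.imp (fun h => huniq X hX A hA (h.trans hAa.symm))
        (fun h => huniq X hX B hB (h.trans hBb.symm))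

theorem inGeneralPosition_pair_iff (U V U' V' : Finset (Fin n)) :
    InGeneralPosition {U, Vᶜ} {U', V'ᶜ} ↔
      (Disjoint U U' ∨ U ∪ U' = Finset.univ) ∧ (U ⊆ V' ∨ V' ⊆ U) ∧ (U' ⊆ V ∨ V ⊆ U') ∧
        (V ∪ V' = Finset.univ ∨ Disjoint V V') := by
  have h1 : ∀ X Y : Finset (Fin n), X ∩ Y = ∅ ↔ Disjoint X Y :=
    fun X Y => Finset.disjoint_iff_inter_eq_empty.symm
  have h2 : ∀ X Y : Finset (Fin n), X ∪ Yᶜ = Finset.univ ↔ Y ⊆ X := fun X Y => by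
    simp only [Finset.ext_iff, Finset.subset_iff, Finset.mem_union, Finset.mem_compl,
      Finset.mem_univ, iff_true]
    exact forall_congr' fun x => by tauto
  have h3 : ∀ X Y : Finset (Fin n), Xᶜ ∪ Y = Finset.univ ↔ X ⊆ Y := fun X Y => by
    rw [Finset.union_comm, h2]
  have h5 : ∀ X Y : Finset (Fin n), Disjoint X Yᶜ ↔ X ⊆ Y := fun X Y => disjoint_compl_right_iff
  have h6 : ∀ X Y : Finset (Fin n), Disjoint Xᶜ Y ↔ Y ⊆ X := fun X Y => by
    rw [disjoint_comm, h5]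
  have h4 : ∀ X Y : Finset (Fin n), X ⊆ Yᶜ ↔ Disjoint X Y := fun X Y =>
    Finset.subset_compl_iff_disjoint_right
  have h7 : ∀ X Y : Finset (Fin n), Xᶜ ⊆ Y ↔ X ∪ Y = Finset.univ := fun X Y => by
    rw [← h2, compl_compl, Finset.union_comm]
  unfold InGeneralPosition
  simp only [Finset.forall_mem_insert, Finset.mem_singleton, forall_eq, h1, h5, h7, h6, h4, h3, h2]
  rw [disjoint_comm (a := V') (b := V)]
  tauto

theorem union_ne_univ {X Y : Finset (Fin n)} (h : X.card + Y.card < n) :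
    X ∪ Y ≠ Finset.univ := fun e => by
  have := Finset.card_union_le X Y
  rw [e, Finset.card_univ, Fintype.card_fin] at this
  omega

/-- Sizes rule out every covering of `[n]` and every inclusion of a larger set in a smaller one.
Disjointness of `U` and `U'` is then redundant, as they lie in the disjoint sets `V'` and `V`. -/
theorem inGeneralPosition_pair_iff_of_card_lt {U V U' V' : Finset (Fin n)}
    (hU : U.card = U'.card) (hV : V.card = V'.card) (hUV : U.card < V.card)
    (hn : 2 * V.card < n) :
    InGeneralPosition {U, Vᶜ} {U', V'ᶜ} ↔ U ⊆ V' ∧ U' ⊆ V ∧ Disjoint V V' := by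
  rw [inGeneralPosition_pair_iff]
  have h1 : U ∪ U' ≠ Finset.univ := union_ne_univ (by omega)
  have h2 : V ∪ V' ≠ Finset.univ := union_ne_univ (by omega)
  have h3 : ¬ V' ⊆ U := fun h => by
    have := Finset.card_le_card h
    omega
  have h4 : ¬ V ⊆ U' := fun h => by
    have := Finset.card_le_card h
    omega
  simp only [h1, h2, h3, h4, or_false, false_or]
  constructor
  · exact fun h => h.2
  · exact fun h => ⟨Finset.disjoint_of_subset_left h.1
      (Finset.disjoint_of_subset_right h.2.1 h.2.2.symm), h⟩

theorem inGeneralPosition_pair_iff_of_card_gt {U V U' V' : Finset (Fin n)}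
    (hU : U.card = U'.card) (hV : V.card = V'.card) (hUV : V.card < U.card)
    (hn : 2 * U.card < n) :
    InGeneralPosition {U, Vᶜ} {U', V'ᶜ} ↔ V ⊆ U' ∧ V' ⊆ U ∧ Disjoint U U' := by
  rw [inGeneralPosition_pair_iff]
  have h1 : U ∪ U' ≠ Finset.univ := union_ne_univ (by omega)
  have h2 : V ∪ V' ≠ Finset.univ := union_ne_univ (by omega)
  have h3 : ¬ U ⊆ V' := fun h => by
    have := Finset.card_le_card h
    omega
  have h4 : ¬ U' ⊆ V := fun h => by
    have := Finset.card_le_card h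
    omega
  simp only [h1, h2, h3, h4, or_false, false_or]
  constructor
  · exact fun h => ⟨h.2.2.1, h.2.1, h.1⟩
  · exact fun h => ⟨h.2.2, h.2.1, h.1, Finset.disjoint_of_subset_left h.1
      (Finset.disjoint_of_subset_right h.2.1 h.2.2.symm)⟩

/-- The general position graph for `a + b < n`, in terms of pairs of disjoint sets. -/
noncomputable def pairRelIsoOfLt (ha : 1 ≤ a) (hb : b < n) (hb' : n < 2 * b) (hab : a + b < n) :
    pairRel (Fin n) a (n - b) ≃r (generalPositionGraph n {a, b}).Adj where
  toEquiv := Equiv.ofBijective _ (DisjointPair.toFlag_bijective ha (by omega) hb)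
  map_rel_iff' := by
    intro v w
    rw [generalPositionGraph_adj (Finset.insert_nonempty _ _)]
    exact inGeneralPosition_pair_iff_of_card_lt (v.card_fst.trans w.card_fst.symm)
      (v.card_snd.trans w.card_snd.symm) (by rw [v.card_fst, v.card_snd]; omega)
      (by rw [v.card_snd]; omega)

/-- The general position graph for `n < a + b`, in terms of pairs of disjoint sets. -/
noncomputable def pairRelIsoOfGt (ha : 1 ≤ a) (hb : b < n) (ha' : 2 * a < n) (hab : n < a + b) :
    pairRel (Fin n) (n - b) a ≃r (generalPositionGraph n {a, b}).Adj where
  toEquiv := DisjointPair.swap.trans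
    (Equiv.ofBijective _ (DisjointPair.toFlag_bijective ha (by omega) hb))
  map_rel_iff' := by
    intro v w
    rw [generalPositionGraph_adj (Finset.insert_nonempty _ _)]
    exact inGeneralPosition_pair_iff_of_card_gt (v.card_snd.trans w.card_snd.symm)
      (v.card_fst.trans w.card_fst.symm) (show v.fst.card < v.snd.card by rw [v.card_fst, v.card_snd]; omega)
      (show 2 * v.snd.card < n by rw [v.card_snd]; omega)

end Flags

theorem theorem3p7 (n a b : ℕ) (hT : ({a, b} : Finset ℕ) ⊆ Finset.Icc 1 (n - 1))
    (ha : (a : ℝ) < (n : ℝ) / 2) (hb : (n : ℝ) / 2 < (b : ℝ)) (hab : a + b ≠ n) :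
    Nonempty ((generalPositionGraph n {a, b} ≃g generalPositionGraph n {a, b}) ≃*
      Equiv.Perm (Fin n)) := by
  have ha1 := Finset.mem_Icc.1 (hT (Finset.mem_insert_self a _))
  have hb1 := Finset.mem_Icc.1 (hT (Finset.mem_insert_of_mem (Finset.mem_singleton_self b)))
  have ha2 : 2 * a < n := by
    have : (2 : ℝ) * a < n := by linarith
    exact_mod_cast this
  have hb2 : n < 2 * b := by
    have : (n : ℝ) < 2 * b := by linarith
    exact_mod_cast this
  -- The sign of `a + b - n` decides which of `a` and `n - b` is smaller and so serves as the first
  -- size; the larger one is below `n / 2` in either case.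
  rcases lt_or_gt_of_ne hab with h | h
  · exact ⟨((permEquivPairRelIso (α := Fin n) ha1.1 (show a < n - b by omega)
      (by rw [Fintype.card_fin]; omega)).trans
      (pairRelIsoOfLt ha1.1 (by omega) hb2 h).autMulEquiv).symm⟩
  · exact ⟨((permEquivPairRelIso (α := Fin n) (show 1 ≤ n - b by omega) (show n - b < a by omega)
      (by rw [Fintype.card_fin]; omega)).trans
      (pairRelIsoOfGt ha1.1 (by omega) ha2 h).autMulEquiv).symm⟩
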